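/- Let $V$ be an infinite set and let $(c_v)_{v\in V}$ be points of the Euclidean plane such that the open disks $B(c_v,\tfrac12)$ ("pennies") are pairwise disjoint. The associated penny graph $G$ has vertex set $V$, with $v\sim w$ if and only if the circles of radius $\tfrac12$ about $c_v$ and $c_w$ are tangent, i.e. $|c_v-c_w|=1$. Assume that $G$ is connected; let $d$ be its combinatorial distance and, for $x\in V$ and real $R\ge 0$, let $|B_R(x)|$ be the number of vertices $y$ with $d(y,x)\le R$. Draw $G$ in the plane by the points $c_v$ and the segments joining $c_v$ to $c_w$ for $v\sim w$. The faces of $G$ are the connected components of the complement of this drawing. The facial degree of a face $\sigma$ is the number, in $\mathbb N\cup\{\infty\}$, of its corners (interior angles), where a corner of $\sigma$ at $v$ is a connected component of $\sigma\cap B(c_v,\tfrac12)$, i.e. an open circular sector between consecutive edges at $v$ (straight angles are counted, and a vertex of degree one gives a single corner of angle $2\pi$). **Theorem.** For every $D\in\mathbb N$ there are positive constants $C_1,C_2,C_3,C_4$, depending only on $D$, such that for every infinite connected penny graph $G$ all of whose faces have facial degree at most $D$: 1. (volume doubling) $|B_{2R}(x)|\le C_1\,|B_R(x)|$ for all $x\in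 V$ and $R>0$; 2. (weak relative volume comparison with exponent $\nu=2$) $\dfrac{|B_R(x)|}{|B_r(x)|}\le C_2\left(\dfrac Rr\right)^{2}$ for all $x\in V$ and $R>r>0$; 3. (quadratic volume growth) $|B_R(x)|$ is finite and $C_3R^2\le |B_R(x)|\le C_4R^2$ for all $x\in V$ and $R\ge 1$. -/

import Mathlib

/-- The Euclidean plane. -/
abbrev Plane : Type := EuclideanSpace ℝ (Fin 2)

/-- A configuration of pennies indexed by `V`: open disks of radius `1/2` in the plane which are
pairwise disjoint. -/
structure PennyConfiguration (V : Type*) where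
  /-- the center of each penny -/
  center : V → Plane
  pairwise_disjoint : Pairwise fun i j : V =>
    Disjoint (Metric.ball (center i) (1 / 2)) (Metric.ball (center j) (1 / 2))

namespace PennyConfiguration

variable {V : Type*} (P : PennyConfiguration V)

/-- The open disk (penny) with index `v`. -/
def penny (v : V) : Set Plane := Metric.ball (P.center v) (1 / 2)

/-- The contact graph. Two circles of radius `1/2` bounding disjoint disks are tangent exactly when
the distance of their centers is `1`. -/
def graph : SimpleGraph V where
  Adj v w := dist (P.center v) (P.center w) = 1
  symm := ⟨fun v w h => by rw [dist_comm]; exact h⟩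
  loopless := ⟨fun v h => by simp at h⟩

/-- The image of the vertices and edges in the plane: the centers of the pennies, and the segments
joining the centers of tangent pennies. -/
def drawing : Set Plane :=
  Set.range P.center ∪
    {p | ∃ v w : V, P.graph.Adj v w ∧ p ∈ segment ℝ (P.center v) (P.center w)}

/-- The faces: the connected components of the complement of the drawing. -/
def faces : Set (Set Plane) :=
  {σ | ∃ p ∈ P.drawingᶜ, σ = connectedComponentIn P.drawingᶜ p}

/-- The corners (interior angles) of a face `σ`. The penny at `v` meets the drawing only in the
radii lying on the edges at `v`, so these radii cut it into open circular sectors. The corners of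
`σ` at `v` are those of these sectors that lie in `σ`, which are the connected components of
`σ ∩ P.penny v`. A straight angle is a corner, and the slit disk at a vertex of degree one
is a corner of angle `2π`. -/
def corners (σ : Set Plane) : Set (Set Plane) :=
  {s | ∃ v : V, ∃ p ∈ σ ∩ P.penny v, s = connectedComponentIn (σ ∩ P.penny v) p}

/-- The facial degree: the number of corners, in `ℕ ∪ {∞}`. -/
noncomputable def facialDegree (σ : Set Plane) : ℕ∞ := (P.corners σ).encard

end PennyConfiguration

namespace SimpleGraph

variable {V : Type*} (G : SimpleGraph V)

/-- The closed ball of radius `R` about `x` in the combinatorial distance (of a connected graph). -/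
def combBall (x : V) (R : ℝ) : Set V := {y | (G.dist y x : ℝ) ≤ R}

/-- The number of vertices in the ball of radius `R` about `x` (for a graph with finite balls). -/
noncomputable def vol (x : V) (R : ℝ) : ℝ := ((G.combBall x R).ncard : ℝ)

/-- The volume doubling property with constant `C`. -/
def VolumeDoubling (C : ℝ) : Prop :=
  ∀ (x : V) (R : ℝ), 0 < R → G.vol x (2 * R) ≤ C * G.vol x R

/-- The weak relative volume comparison with constant `C` and exponent `ν`. -/
def WeakRelativeVolumeComparison (C ν : ℝ) : Prop :=
  ∀ (x : V) (R r : ℝ), 0 < r → r < R → G.vol x R / G.vol x r ≤ C * (R / r) ^ ν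

end SimpleGraph

/-!
The upper volume bound is packing: a graph ball lies in a Euclidean disk of the same radius, and the
pennies are disjoint. For the lower bound, a face and its complement are connected, so by
unicoherence of the plane the `ε`-neighborhoods of the boundary of the face are connected. The
pennies at the corners of the face, slightly enlarged, cover such a neighborhood and therefore form
a chain: two corner vertices of a face have graph distance at most `D`. Hence faces have bounded
diameter. The face stars, that is, the unions of the faces around a vertex, cover the plane, and a
segment of length one meets boundedly many of them, so graph distances are at most a constant times
Euclidean distances plus a constant. Disks of bounded radius about the vertices of a graph ball of
radius `R` thus cover a Euclidean disk of radius comparable to `R`, whose area bounds their number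
from below.
-/

open Set Metric Topology MeasureTheory

section VolumeGrowth

variable {V : Type*} {G : SimpleGraph V}

theorem weakRelativeVolumeComparison_of_vol_bounds {A B ν : ℝ} (hA : 0 ≤ A) (hB : 0 ≤ B)
    (hν : 0 ≤ ν) (hlower : ∀ (x : V) (R : ℝ), 0 ≤ R → (R + 1) ^ ν ≤ A * G.vol x R)
    (hupper : ∀ (x : V) (R : ℝ), 0 ≤ R → G.vol x R ≤ B * (R + 1) ^ ν) :
    G.WeakRelativeVolumeComparison (A * B) ν := by
  intro x R r hr hrR
  have hR : 0 < R := hr.trans hrR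
  have hpow : 0 < (r + 1) ^ ν := Real.rpow_pos_of_pos (by linarith) ν
  have hvol : 0 < G.vol x r := pos_of_mul_pos_right (hpow.trans_le (hlower x r hr.le)) hA
  have hratio : (R + 1) / (r + 1) ≤ R / r := by
    rw [div_le_div_iff₀ (by linarith) hr]
    nlinarith
  calc G.vol x R / G.vol x r
      ≤ B * (R + 1) ^ ν / G.vol x r := by gcongr; exact hupper x R hR.le
    _ ≤ A * B * ((R + 1) ^ ν / (r + 1) ^ ν) := by
      rw [mul_div_assoc', div_le_div_iff₀ hvol hpow]
      have := mul_le_mul_of_nonneg_left (hlower x r hr.le)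
        (mul_nonneg hB (Real.rpow_nonneg (by linarith : 0 ≤ R + 1) ν))
      linarith
    _ = A * B * ((R + 1) / (r + 1)) ^ ν := by rw [Real.div_rpow (by linarith) (by linarith)]
    _ ≤ A * B * (R / r) ^ ν := by gcongr

theorem volumeDoubling_of_weakRelativeVolumeComparison {C ν : ℝ}
    (hvol : ∀ (x : V) (R : ℝ), 0 < R → 0 < G.vol x R) (h : G.WeakRelativeVolumeComparison C ν) :
    G.VolumeDoubling (C * 2 ^ ν) := by
  intro x R hR
  rw [← div_le_iff₀ (hvol x R hR)]
  simpa only [mul_div_cancel_right₀ (2 : ℝ) hR.ne'] using h x (2 * R) R hR (by linarith)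

end VolumeGrowth

section ConnectedSets

variable {X : Type*} [TopologicalSpace X]

theorem inter_frontier_nonempty_of_isPreconnected {s t : Set X} (ht : IsPreconnected t)
    (hs : (t ∩ s).Nonempty) (hsc : (t ∩ sᶜ).Nonempty) : (t ∩ frontier s).Nonempty := by
  by_contra hempty
  have hinterior : ∀ x ∈ t, x ∈ closure s → x ∈ interior s := fun x hx hxs => by
    by_contra hxi
    exact hempty ⟨x, hx, hxs, hxi⟩
  obtain ⟨x, hxt, hxs⟩ := hs
  obtain ⟨y, hyt, hys⟩ := hsc
  have hsub : t ⊆ interior s := ht.subset_of_closure_inter_subset isOpen_interior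
    ⟨x, hxt, hinterior x hxt (subset_closure hxs)⟩
    fun z hz => hinterior z hz.2 (closure_mono interior_subset hz.1)
  exact hys (interior_subset (hsub hyt))

theorem frontier_connectedComponentIn_subset_compl [LocallyConnectedSpace X] {U : Set X}
    (hU : IsOpen U) (x : X) : frontier (connectedComponentIn U x) ⊆ Uᶜ := by
  intro q hq hqU
  rw [hU.connectedComponentIn.frontier_eq] at hq
  obtain ⟨z, hzq, hzx⟩ := mem_closure_iff.1 hq.1 _ hU.connectedComponentIn
    (mem_connectedComponentIn hqU)
  apply hq.2
  rw [connectedComponentIn_eq hzx, ← connectedComponentIn_eq hzq]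
  exact mem_connectedComponentIn hqU

theorem isPreconnected_compl_connectedComponentIn_compl [LocallyConnectedSpace X]
    [PreconnectedSpace X] {F : Set X} (hF : IsClosed F) (hFc : IsConnected F) (x : X) :
    IsPreconnected (connectedComponentIn Fᶜ x)ᶜ := by
  obtain ⟨a, ha⟩ := hFc.nonempty
  have hFsub : F ⊆ (connectedComponentIn Fᶜ x)ᶜ :=
    subset_compl_comm.1 (connectedComponentIn_subset _ _)
  refine isPreconnected_of_forall a fun y hy => ?_
  by_cases hyF : y ∈ F
  · exact ⟨F, hFsub, ha, hyF, hFc.isPreconnected⟩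
  have hyC : y ∈ connectedComponentIn Fᶜ y := mem_connectedComponentIn hyF
  have hfrontier : frontier (connectedComponentIn Fᶜ y) ⊆ F :=
    (frontier_connectedComponentIn_subset_compl hF.isOpen_compl y).trans_eq (compl_compl F)
  obtain ⟨z, hz⟩ : (frontier (connectedComponentIn Fᶜ y)).Nonempty :=
    nonempty_frontier_iff.2 ⟨⟨y, hyC⟩,
      (ne_univ_iff_exists_notMem _).2 ⟨a, fun h => connectedComponentIn_subset _ _ h ha⟩⟩
  refine ⟨closure (connectedComponentIn Fᶜ y) ∪ F, union_subset ?_ hFsub, Or.inr ha,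
    Or.inl (subset_closure hyC),
    isPreconnected_connectedComponentIn.closure.union z (frontier_subset_closure hz)
      (hfrontier hz) hFc.isPreconnected⟩
  rw [closure_eq_self_union_frontier]
  refine union_subset (fun w hwy hwx => hy ?_) (hfrontier.trans hFsub)
  rwa [connectedComponentIn_eq hwx, ← connectedComponentIn_eq hwy]

end ConnectedSets

section Unicoherence

variable {X : Type*} [TopologicalSpace X]

theorem continuousOn_indicator_of_eqOn_zero {Y : Type*} [TopologicalSpace Y] [Zero Y]
    {U A B : Set X} {g : X → Y} (hA : IsOpen A) (hB : IsOpen B) (hAB : Disjoint A B)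
    (hg : ContinuousOn g U) (hzero : EqOn g 0 (U \ (A ∪ B))) : ContinuousOn (A.indicator g) U := by
  classical
  rw [← piecewise_eq_indicator]
  refine ContinuousOn.piecewise (fun x hx => ?_) (hg.mono inter_subset_left) continuousOn_const
  have hxA : x ∉ A := (hA.frontier_eq ▸ hx.2).2
  have hxB : x ∉ B :=
    disjoint_left.1 (hAB.symm.closure_right hB).symm (frontier_subset_closure hx.2)
  exact hzero ⟨hx.1, fun h => h.elim hxA hxB⟩

theorem exists_continuousMap_coe_addCircle_eq [SimplyConnectedSpace X]
    [LocallyPathConnectedSpace X] {U V : Set X} (hU : IsOpen U) (hV : IsOpen V)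
    (hUV : U ∪ V = univ) {φ ψ : X → ℝ} (hφ : ContinuousOn φ U) (hψ : ContinuousOn ψ V)
    (hφψ : ∀ x, (φ x : UnitAddCircle) = ψ x) :
    ∃ θ : C(X, ℝ), ∀ x, (θ x : UnitAddCircle) = φ x := by
  have hmk : Continuous fun t : ℝ => (t : UnitAddCircle) := AddCircle.continuous_mk' 1
  have hcont : Continuous fun x => (φ x : UnitAddCircle) := by
    refine continuous_iff_continuousAt.2 fun x => ?_
    rcases (hUV ▸ mem_univ x : x ∈ U ∪ V) with hx | hx
    · exact hmk.continuousAt.comp (hφ.continuousAt (hU.mem_nhds hx))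
    · simp_rw [hφψ]
      exact hmk.continuousAt.comp (hψ.continuousAt (hV.mem_nhds hx))
  obtain ⟨a⟩ : Nonempty X := inferInstance
  obtain ⟨θ, ⟨-, hθ⟩, -⟩ := (AddCircle.isCoveringMap_coe 1).existsUnique_continuousMap_lifts
    ⟨_, hcont⟩ a (φ a) rfl
  exact ⟨θ, congrFun hθ⟩

theorem sub_eq_sub_of_coe_addCircle_eq {S : Set X} (hS : IsPreconnected S) {φ θ : X → ℝ}
    (hφ : ContinuousOn φ S) (hθ : ContinuousOn θ S)
    (h : ∀ x ∈ S, (θ x : UnitAddCircle) = φ x) {a b : X} (ha : a ∈ S) (hb : b ∈ S) :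
    φ a - θ a = φ b - θ b := by
  have hdiscrete : IsDiscrete (AddSubgroup.zmultiples (1 : ℝ) : Set ℝ) :=
    ⟨inferInstanceAs (DiscreteTopology (AddSubgroup.zmultiples (1 : ℝ)))⟩
  refine hS.constant_of_mapsTo hdiscrete (hφ.sub hθ) (fun x hx => ?_) ha hb
  rw [Pi.sub_apply, sub_eq_neg_add]
  exact QuotientAddGroup.eq.1 (h x hx)

/- If `U ∩ V` had a clopen part `A` separating `a` from `b`, a function jumping by `1` along `A`
only would be continuous to the circle; its real lift would have to differ from itself by `1`. -/
theorem isPreconnected_inter_of_union_eq_univ [NormalSpace X] [SimplyConnectedSpace X]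
    [LocallyPathConnectedSpace X] {U V : Set X} (hU : IsOpen U) (hV : IsOpen V)
    (hUc : IsPreconnected U) (hVc : IsPreconnected V) (hUV : U ∪ V = univ) :
    IsPreconnected (U ∩ V) := by
  rintro A₀ B₀ hA₀ hB₀ hcov ⟨a, ha, haA₀⟩ ⟨b, hb, hbB₀⟩
  by_contra hempty
  set A := U ∩ V ∩ A₀
  set B := U ∩ V ∩ B₀
  have hA : IsOpen A := (hU.inter hV).inter hA₀
  have hB : IsOpen B := (hU.inter hV).inter hB₀
  have hAB : Disjoint A B :=
    disjoint_left.2 fun x hxA hxB => hempty ⟨x, hxA.1, hxA.2, hxB.2⟩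
  have hUVAB : U ∩ V ⊆ A ∪ B := fun x hx => (hcov hx).imp (⟨hx, ·⟩) (⟨hx, ·⟩)
  obtain ⟨f, hf₀, hf₁, -⟩ := exists_continuous_zero_one_of_isClosed hV.isClosed_compl
    hU.isClosed_compl (by rw [disjoint_compl_left_iff_subset, compl_subset_iff_union, hUV])
  have hφ : ContinuousOn (A.indicator f) U :=
    continuousOn_indicator_of_eqOn_zero hA hB hAB f.continuous.continuousOn
      fun x hx => hf₀ fun hxV => hx.2 (hUVAB ⟨hx.1, hxV⟩)
  have hψ : ContinuousOn (A.indicator fun x => f x - 1) V :=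
    continuousOn_indicator_of_eqOn_zero hA hB hAB (by fun_prop)
      fun x hx => sub_eq_zero.2 (hf₁ fun hxU => hx.2 (hUVAB ⟨hxU, hx.1⟩))
  have hφψ (x : X) : ((A.indicator f x : ℝ) : UnitAddCircle) =
      (A.indicator (fun x => f x - 1) x : ℝ) := by
    by_cases hx : x ∈ A
    · rw [indicator_of_mem hx, indicator_of_mem hx, AddCircle.coe_sub, AddCircle.coe_period,
        sub_zero]
    · rw [indicator_of_notMem hx, indicator_of_notMem hx]
  obtain ⟨θ, hθ⟩ := exists_continuousMap_coe_addCircle_eq hU hV hUV hφ hψ hφψ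
  have hU_const := sub_eq_sub_of_coe_addCircle_eq hUc hφ θ.continuous.continuousOn
    (fun x _ => hθ x) ha.1 hb.1
  have hV_const := sub_eq_sub_of_coe_addCircle_eq hVc hψ θ.continuous.continuousOn
    (fun x _ => (hθ x).trans (hφψ x)) ha.2 hb.2
  have haA : a ∈ A := ⟨ha, haA₀⟩
  have hbA : b ∉ A := disjoint_right.1 hAB ⟨hb, hbB₀⟩
  rw [indicator_of_mem haA, indicator_of_notMem hbA] at hU_const hV_const
  linarith

end Unicoherence

section NormedSpaces

variable {E : Type*} [NormedAddCommGroup E] [NormedSpace ℝ E]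

theorem isPreconnected_thickening {s : Set E} (hs : IsPreconnected s) {ε : ℝ} (hε : 0 < ε) :
    IsPreconnected (thickening ε s) := by
  rcases s.eq_empty_or_nonempty with rfl | ⟨x₀, hx₀⟩
  · simpa only [thickening_empty] using isPreconnected_empty
  refine isPreconnected_of_forall x₀ fun y hy => ?_
  obtain ⟨x, hx, hyx⟩ := mem_thickening_iff.1 hy
  exact ⟨s ∪ ball x ε,
    union_subset (self_subset_thickening hε s) (ball_subset_thickening hx ε),
    Or.inl hx₀, Or.inr hyx,
    hs.union x hx (mem_ball_self hε) (convex_ball x ε).isPreconnected⟩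

theorem thickening_inter_thickening_compl (s : Set E) (ε : ℝ) :
    thickening ε s ∩ thickening ε sᶜ = thickening ε (frontier s) := by
  have hcross : ∀ {x y : E} {t : Set E}, x ∈ t → y ∈ tᶜ → dist x y < ε →
      x ∈ thickening ε (frontier t) := by
    intro x y t hx hy hxy
    obtain ⟨q, hq, hqt⟩ := inter_frontier_nonempty_of_isPreconnected
      (convex_segment x y).isPreconnected ⟨x, left_mem_segment .., hx⟩ ⟨y, right_mem_segment .., hy⟩
    refine mem_thickening_iff.2 ⟨q, hqt, ?_⟩
    linarith [dist_add_dist_of_mem_segment hq, dist_nonneg (x := q) (y := y)]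
  refine Subset.antisymm ?_ fun x hx => ?_
  · rintro x ⟨hxs, hxsc⟩
    by_cases hx : x ∈ s
    · obtain ⟨y, hy, hxy⟩ := mem_thickening_iff.1 hxsc
      exact hcross hx hy hxy
    · obtain ⟨y, hy, hxy⟩ := mem_thickening_iff.1 hxs
      rw [← frontier_compl]
      exact hcross hx (not_not_intro hy) hxy
  · obtain ⟨q, hq, hxq⟩ := mem_thickening_iff.1 hx
    have hmono : ∀ t : Set E, q ∈ closure t → x ∈ thickening ε t := fun t hqt => by
      rw [← thickening_closure]
      exact mem_thickening_iff.2 ⟨q, hqt, hxq⟩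
    exact ⟨hmono s (frontier_subset_closure hq),
      hmono sᶜ (frontier_subset_closure (frontier_compl s ▸ hq))⟩

theorem isPreconnected_thickening_frontier {s : Set E} (hs : IsPreconnected s)
    (hsc : IsPreconnected sᶜ) {ε : ℝ} (hε : 0 < ε) :
    IsPreconnected (thickening ε (frontier s)) := by
  rw [← thickening_inter_thickening_compl]
  refine isPreconnected_inter_of_union_eq_univ isOpen_thickening isOpen_thickening
    (isPreconnected_thickening hs hε) (isPreconnected_thickening hsc hε) (univ_subset_iff.1 ?_)
  rw [← union_compl_self s]
  exact union_subset_union (self_subset_thickening hε s) (self_subset_thickening hε sᶜ)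

theorem isPreconnected_compl_closedBall (hE : 1 < Module.rank ℝ E) (c : E) {r : ℝ} (hr : 0 ≤ r) :
    IsPreconnected (closedBall c r)ᶜ := by
  have himage : (fun x : ℝ × E => c + x.1 • x.2) '' Ioi r ×ˢ sphere 0 1 = (closedBall c r)ᶜ := by
    ext y
    simp only [mem_image, mem_prod, mem_Ioi, mem_sphere_zero_iff_norm, Prod.exists, mem_compl_iff,
      mem_closedBall, not_le, dist_eq_norm]
    constructor
    · rintro ⟨t, u, ⟨ht, hu⟩, rfl⟩
      rwa [add_sub_cancel_left, norm_smul, hu, mul_one, Real.norm_of_nonneg (hr.trans ht.le)]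
    · intro hy
      have hpos : ‖y - c‖ ≠ 0 := (hr.trans_lt hy).ne'
      refine ⟨‖y - c‖, ‖y - c‖⁻¹ • (y - c), ⟨hy, ?_⟩, ?_⟩
      · rw [norm_smul, norm_inv, norm_norm, inv_mul_cancel₀ hpos]
      · rw [smul_inv_smul₀ hpos, add_sub_cancel]
  rw [← himage]
  exact (isPreconnected_Ioi.prod (isConnected_sphere hE 0 zero_le_one).isPreconnected).image _
    (by fun_prop)

end NormedSpaces

section Covers

variable {X ι V : Type*}

/-- The intersection graph of a family of sets, that is, the 1-skeleton of its nerve. -/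
def intersectionGraph (O : ι → Set X) : SimpleGraph ι :=
  SimpleGraph.fromRel fun i j => (O i ∩ O j).Nonempty

theorem intersectionGraph_adj {O : ι → Set X} {i j : ι} :
    (intersectionGraph O).Adj i j ↔ i ≠ j ∧ (O i ∩ O j).Nonempty := by
  rw [intersectionGraph, SimpleGraph.fromRel_adj, inter_comm (O j), or_self]

theorem preconnected_intersectionGraph [TopologicalSpace X] {U : Set X} (hU : IsPreconnected U)
    {O : ι → Set X} (hO : ∀ i, IsOpen (O i)) (hcov : U ⊆ ⋃ i, O i)
    (hne : ∀ i, (U ∩ O i).Nonempty) : (intersectionGraph O).Preconnected := by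
  have := isPreconnected_iff_preconnectedSpace.1 hU
  let O' (i : ι) : Set U := Subtype.val ⁻¹' O i
  have hO'_univ : ⋃ i, O' i = univ := by
    rw [← preimage_iUnion, preimage_eq_univ_iff, Subtype.range_coe]
    exact hcov
  have hO'_ne (i : ι) : (O' i).Nonempty := Subtype.preimage_coe_nonempty.2 (hne i)
  have hstep {i j : ι} (h : (O' i ∩ O' j).Nonempty) : (intersectionGraph O).Reachable i j := by
    rcases eq_or_ne i j with rfl | hij
    · rfl
    · exact (intersectionGraph_adj.2 ⟨hij, h.image Subtype.val |>.mono
        (image_preimage_subset Subtype.val (O i ∩ O j))⟩).reachable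
  intro i j
  refine Relation.TransGen.trans_induction_on (IsPreconnected.transGen_of_iUnion
    (hO'_univ ▸ isPreconnected_univ) (fun i => (hO i).preimage continuous_subtype_val) i j
    (hO'_ne i) (hO'_ne j)) hstep fun _ _ => SimpleGraph.Reachable.trans

variable {G : SimpleGraph V}

theorem dist_map_le_mul_length {H : SimpleGraph ι} {f : ι → V} {k : ℕ} (hG : G.Connected)
    (h : ∀ i j, H.Adj i j → G.dist (f i) (f j) ≤ k) {i j : ι} (p : H.Walk i j) :
    G.dist (f i) (f j) ≤ k * p.length := by
  induction p with
  | nil => rw [SimpleGraph.dist_self]; exact Nat.zero_le _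
  | @cons a b c hadj p ih =>
    calc G.dist (f a) (f c)
        ≤ G.dist (f a) (f b) + G.dist (f b) (f c) := hG.dist_triangle
      _ ≤ k + k * p.length := add_le_add (h _ _ hadj) ih
      _ = k * (p.cons hadj).length := by rw [SimpleGraph.Walk.length_cons]; ring

theorem dist_map_le_mul_card [Finite ι] {H : SimpleGraph ι} (hH : H.Preconnected) {f : ι → V}
    {k : ℕ} (hG : G.Connected) (h : ∀ i j, H.Adj i j → G.dist (f i) (f j) ≤ k) (i j : ι) :
    G.dist (f i) (f j) ≤ k * Nat.card ι := by
  classical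
  have := Fintype.ofFinite ι
  obtain ⟨p⟩ := hH i j
  refine (dist_map_le_mul_length hG h p.toPath.1).trans (Nat.mul_le_mul_left k ?_)
  rw [Nat.card_eq_fintype_card]
  exact p.toPath.2.length_lt.le

theorem dist_map_le_mul_card_of_cover [TopologicalSpace X] [Finite ι] {U : Set X}
    (hU : IsPreconnected U) {O : ι → Set X} (hO : ∀ i, IsOpen (O i)) (hcov : U ⊆ ⋃ i, O i)
    (hne : ∀ i, (U ∩ O i).Nonempty) {f : ι → V} {k : ℕ} (hG : G.Connected)
    (h : ∀ i j, (O i ∩ O j).Nonempty → G.dist (f i) (f j) ≤ k) (i j : ι) :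
    G.dist (f i) (f j) ≤ k * Nat.card ι :=
  dist_map_le_mul_card (preconnected_intersectionGraph hU hO hcov hne) hG
    (fun i j hij => h i j (intersectionGraph_adj.1 hij).2) i j

theorem dist_le_mul_of_unit_scale {E : Type*} [NormedAddCommGroup E] [NormedSpace ℝ E]
    {O : V → Set E} {k : ℕ} (hG : G.Connected) (hcov : ∀ p, ∃ v, p ∈ O v)
    (hunit : ∀ {p q : E} {v w : V}, p ∈ O v → q ∈ O w → dist p q ≤ 1 → G.dist v w ≤ k)
    (n : ℕ) {p q : E} {v w : V} (hp : p ∈ O v) (hq : q ∈ O w) (hpq : dist p q ≤ n + 1) :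
    G.dist v w ≤ (n + 1) * k := by
  induction n generalizing q w with
  | zero => simpa only [zero_add, one_mul] using hunit hp hq (by simpa using hpq)
  | succ n ih =>
    push_cast at hpq
    set s : ℝ := (n + 1) / (n + 2)
    have hs : s * (n + 2) = n + 1 := div_mul_cancel₀ _ (by positivity)
    have hs₀ : 0 ≤ s := by positivity
    have hs₁ : s ≤ 1 := (div_le_one (by positivity)).2 (by linarith)
    obtain ⟨u, hu⟩ := hcov (AffineMap.lineMap p q s)
    have hpu : dist p (AffineMap.lineMap p q s) ≤ n + 1 := by
      rw [dist_left_lineMap, Real.norm_of_nonneg hs₀]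
      nlinarith
    have huq : dist (AffineMap.lineMap p q s) q ≤ 1 := by
      rw [dist_lineMap_right, Real.norm_of_nonneg (sub_nonneg.2 hs₁)]
      nlinarith
    calc G.dist v w ≤ G.dist v u + G.dist u w := hG.dist_triangle
      _ ≤ (n + 1) * k + k := add_le_add (ih hu hpu) (hunit hu hq huq)
      _ = (n + 1 + 1) * k := by ring

theorem exists_pos_forall_lt_add_imp_le [Finite ι] (f : ι → ℝ) (a : ℝ) :
    ∃ ε > 0, ∀ i, f i < a + ε → f i ≤ a := by
  have hsmall (i : ι) : ∀ᶠ ε in 𝓝[>] (0 : ℝ), f i < a + ε → f i ≤ a := by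
    by_cases hi : f i ≤ a
    · exact .of_forall fun _ _ => hi
    · filter_upwards [Ioo_mem_nhdsGT (sub_pos.2 (not_le.1 hi))] with ε hε h
      exact absurd h (by linarith [hε.2])
  obtain ⟨ε, hε, hpos⟩ := ((Filter.eventually_all.2 hsmall).and self_mem_nhdsWithin).exists
  exact ⟨ε, hpos, hε⟩

end Covers

section Volumes

variable {E : Type*} [NormedAddCommGroup E] [NormedSpace ℝ E] [FiniteDimensional ℝ E] {ι : Type*}

theorem addHaar_real_ball_of_pos [MeasurableSpace E] [BorelSpace E] (μ : Measure E)
    [μ.IsAddHaarMeasure] (x : E) {r : ℝ} (hr : 0 < r) :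
    μ.real (ball x r) = r ^ Module.finrank ℝ E * μ.real (ball 0 1) := by
  rw [measureReal_def, μ.addHaar_ball_of_pos x hr, ENNReal.toReal_mul,
    ENNReal.toReal_ofReal (by positivity), measureReal_def]

theorem card_mul_pow_le_of_pairwiseDisjoint_ball {c : ι → E} {t : Finset ι} {p : E} {r L : ℝ}
    (hr : 0 < r) (hL : 0 ≤ L) (hdisj : (t : Set ι).PairwiseDisjoint fun i => ball (c i) r)
    (ht : ∀ i ∈ t, c i ∈ closedBall p L) :
    t.card * r ^ Module.finrank ℝ E ≤ (L + r) ^ Module.finrank ℝ E := by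
  borelize E
  let μ : Measure E := Measure.addHaar
  have hunit : 0 < μ.real (ball 0 1) :=
    ENNReal.toReal_pos (measure_ball_pos μ 0 one_pos).ne' measure_ball_lt_top.ne
  refine le_of_mul_le_mul_right ?_ hunit
  calc t.card * r ^ Module.finrank ℝ E * μ.real (ball 0 1)
      = ∑ i ∈ t, μ.real (ball (c i) r) := by
        simp only [addHaar_real_ball_of_pos μ _ hr, Finset.sum_const, nsmul_eq_mul, mul_assoc]
    _ = μ.real (⋃ i ∈ t, ball (c i) r) := (measureReal_biUnion_finset hdisj
        (fun _ _ => measurableSet_ball) fun _ _ => measure_ball_lt_top.ne).symm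
    _ ≤ μ.real (ball p (L + r)) := by
        refine measureReal_mono (iUnion₂_subset fun i hi => ?_) measure_ball_lt_top.ne
        exact ball_subset_ball' (by linarith [mem_closedBall.1 (ht i hi)])
    _ = (L + r) ^ Module.finrank ℝ E * μ.real (ball 0 1) :=
        addHaar_real_ball_of_pos μ p (by linarith)

theorem pow_le_card_mul_pow_of_ball_subset {c : ι → E} {t : Finset ι} {p : E} {r L : ℝ}
    (hr : 0 ≤ r) (hL : 0 < L) (hcov : ball p L ⊆ ⋃ i ∈ t, closedBall (c i) r) :
    L ^ Module.finrank ℝ E ≤ t.card * r ^ Module.finrank ℝ E := by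
  borelize E
  let μ : Measure E := Measure.addHaar
  have hunit : 0 < μ.real (ball 0 1) :=
    ENNReal.toReal_pos (measure_ball_pos μ 0 one_pos).ne' measure_ball_lt_top.ne
  have hfin : μ (⋃ i ∈ t, closedBall (c i) r) ≠ ⊤ :=
    ((measure_biUnion_finset_le _ _).trans_lt
      (ENNReal.sum_lt_top.2 fun i _ => measure_closedBall_lt_top)).ne
  refine le_of_mul_le_mul_right ?_ hunit
  calc L ^ Module.finrank ℝ E * μ.real (ball 0 1)
      = μ.real (ball p L) := (addHaar_real_ball_of_pos μ p hL).symm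
    _ ≤ μ.real (⋃ i ∈ t, closedBall (c i) r) := measureReal_mono hcov hfin
    _ ≤ ∑ i ∈ t, μ.real (closedBall (c i) r) := measureReal_biUnion_finset_le _ _
    _ = t.card * r ^ Module.finrank ℝ E * μ.real (ball 0 1) := by
        simp only [μ.addHaar_real_closedBall _ hr, Finset.sum_const, nsmul_eq_mul, mul_assoc]

theorem addHaar_segment [MeasurableSpace E] [BorelSpace E] (μ : Measure E) [μ.IsAddHaarMeasure]
    (hE : 1 < Module.finrank ℝ E) (a b : E) : μ (segment ℝ a b) = 0 := by
  refine measure_mono_null (t := (affineSpan ℝ {a, b} : Set E)) ?_ ?_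
  · rw [← convexHull_pair]
    exact convexHull_subset_affineSpan _
  · refine μ.addHaar_affineSubspace _ fun htop => hE.not_ge ?_
    have hle := (collinear_pair ℝ a b).finrank_le_one
    rwa [← direction_affineSpan, htop, AffineSubspace.direction_top, finrank_top] at hle

end Volumes

section InnerProductSpaces

variable {E : Type*} [NormedAddCommGroup E] [InnerProductSpace ℝ E]

theorem dist_sq_lineMap (a b x : E) (s : ℝ) :
    dist (AffineMap.lineMap a b s) x ^ 2 =
      (1 - s) * dist a x ^ 2 + s * dist b x ^ 2 - s * (1 - s) * dist a b ^ 2 := by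
  have h₁ : AffineMap.lineMap a b s - x = (1 - s) • (a - x) + s • (b - x) := by
    rw [AffineMap.lineMap_apply_module]; module
  have h₂ : a - b = (a - x) - (b - x) := by abel
  rw [dist_eq_norm, dist_eq_norm, dist_eq_norm, dist_eq_norm, h₁, h₂, norm_add_sq_real,
    norm_sub_sq_real (a - x), norm_smul, norm_smul, inner_smul_left, inner_smul_right, mul_pow,
    mul_pow, Real.norm_eq_abs, Real.norm_eq_abs, sq_abs, sq_abs]
  simp only [conj_trivial]
  ring

theorem sq_le_four_mul_dist_sq_lineMap_lineMap_left {v w b : E} (hvw : dist v w = 1)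
    (hvb : dist v b ≤ 1) (hwb : 1 ≤ dist w b) {s t : ℝ} (hs : 0 ≤ s) (ht : 0 ≤ t) :
    t ^ 2 ≤ 4 * dist (AffineMap.lineMap v b s) (AffineMap.lineMap v w t : E) ^ 2 := by
  have hexpand : dist (AffineMap.lineMap v b s) (AffineMap.lineMap v w t : E) ^ 2 =
      t ^ 2 + s * t * (dist w b ^ 2 - 1) + dist v b ^ 2 * (s * (s - t)) := by
    rw [dist_sq_lineMap, dist_comm v (AffineMap.lineMap _ _ _),
      dist_comm b (AffineMap.lineMap _ _ _), dist_sq_lineMap, dist_sq_lineMap, dist_self,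
      dist_comm w v, hvw]
    ring
  have hwb_sq : 0 ≤ s * t * (dist w b ^ 2 - 1) :=
    mul_nonneg (mul_nonneg hs ht) (sub_nonneg.2 (one_le_pow₀ hwb))
  have hvb_sq : dist v b ^ 2 ≤ 1 := pow_le_one₀ dist_nonneg hvb
  have hst : -t ^ 2 / 4 ≤ s * (s - t) := by nlinarith [sq_nonneg (s - t / 2)]
  rw [hexpand]
  nlinarith [mul_le_mul_of_nonneg_left hst (sq_nonneg (dist v b)),
    mul_le_mul_of_nonneg_right hvb_sq (sq_nonneg t)]

theorem one_le_two_mul_dist_sq_lineMap_lineMap {v w a b : E} (hvw : dist v w ≤ 1)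
    (hab : dist a b ≤ 1) (hav : 1 ≤ dist a v) (haw : 1 ≤ dist a w) (hbv : 1 ≤ dist b v)
    (hbw : 1 ≤ dist b w) {s t : ℝ} (hs : s ∈ Icc (0 : ℝ) 1) (ht : t ∈ Icc (0 : ℝ) 1) :
    1 ≤ 2 * dist (AffineMap.lineMap a b s) (AffineMap.lineMap v w t : E) ^ 2 := by
  have hfrom {c : E} (hcv : 1 ≤ dist c v) (hcw : 1 ≤ dist c w) :
      3 / 4 ≤ dist c (AffineMap.lineMap v w t : E) ^ 2 := by
    rw [dist_comm, dist_sq_lineMap, dist_comm v c, dist_comm w c]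
    have hvw_sq : dist v w ^ 2 ≤ 1 := pow_le_one₀ dist_nonneg hvw
    nlinarith [mul_le_mul_of_nonneg_left (one_le_pow₀ hcv : 1 ≤ dist c v ^ 2) (sub_nonneg.2 ht.2),
      mul_le_mul_of_nonneg_left (one_le_pow₀ hcw : 1 ≤ dist c w ^ 2) ht.1,
      mul_le_mul_of_nonneg_left hvw_sq (mul_nonneg ht.1 (sub_nonneg.2 ht.2)),
      sq_nonneg (t - 1 / 2)]
  have hab_sq : dist a b ^ 2 ≤ 1 := pow_le_one₀ dist_nonneg hab
  rw [dist_sq_lineMap]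
  nlinarith [mul_le_mul_of_nonneg_left (hfrom hav haw) (sub_nonneg.2 hs.2),
    mul_le_mul_of_nonneg_left (hfrom hbv hbw) hs.1,
    mul_le_mul_of_nonneg_left hab_sq (mul_nonneg hs.1 (sub_nonneg.2 hs.2)), sq_nonneg (s - 1 / 2)]

end InnerProductSpaces

namespace PennyConfiguration

variable {V : Type*} (P : PennyConfiguration V)

section Distances

theorem one_le_dist {v w : V} (h : v ≠ w) : 1 ≤ dist (P.center v) (P.center w) := by
  by_contra! hlt
  refine disjoint_left.1 (P.pairwise_disjoint h)
    (?_ : midpoint ℝ (P.center v) (P.center w) ∈ _) ?_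
  · rw [mem_ball, dist_midpoint_left, Real.norm_of_nonneg zero_le_two]
    linarith
  · rw [mem_ball, dist_midpoint_right, Real.norm_of_nonneg zero_le_two]
    linarith

theorem graph_dist_le_one {v w : V} (h : dist (P.center v) (P.center w) ≤ 1) :
    P.graph.dist v w ≤ 1 := by
  rcases eq_or_ne v w with rfl | hne
  · rw [SimpleGraph.dist_self]
    exact zero_le_one
  · exact (SimpleGraph.dist_eq_one_iff_adj.2 (h.antisymm (P.one_le_dist hne))).le

theorem dist_center_le_graph_dist (hconn : P.graph.Connected) (v w : V) :
    dist (P.center v) (P.center w) ≤ P.graph.dist v w := by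
  obtain ⟨p, hp⟩ := hconn.exists_walk_length_eq_dist v w
  rw [← hp]
  clear hp
  induction p with
  | nil => rw [dist_self]; positivity
  | @cons a b c hadj p ih =>
    have hab : dist (P.center a) (P.center b) = 1 := hadj
    rw [SimpleGraph.Walk.length_cons]
    push_cast
    linarith [dist_triangle (P.center a) (P.center b) (P.center c)]

theorem card_le_of_mem_closedBall {p : Plane} {L : ℝ} (hL : 0 ≤ L) (t : Finset V)
    (ht : ∀ v ∈ t, P.center v ∈ closedBall p L) : t.card ≤ (2 * L + 1) ^ 2 := by
  have hpack := card_mul_pow_le_of_pairwiseDisjoint_ball one_half_pos hL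
    (P.pairwise_disjoint.set_pairwise t) ht
  rw [finrank_euclideanSpace_fin] at hpack
  linarith

theorem finite_setOf_center_mem_closedBall (p : Plane) (L : ℝ) :
    {v | P.center v ∈ closedBall p L}.Finite := by
  by_contra hinf
  obtain ⟨v₀, hv₀⟩ := Set.Infinite.nonempty hinf
  obtain ⟨n, hn⟩ := exists_nat_gt ((2 * L + 1) ^ 2)
  obtain ⟨t, ht, hcard⟩ := Set.Infinite.exists_subset_card_eq hinf n
  have hle := P.card_le_of_mem_closedBall (dist_nonneg.trans hv₀) t ht
  exact hn.not_ge (hcard ▸ hle)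

theorem ncard_setOf_center_mem_closedBall_le (p : Plane) {L : ℝ} (hL : 0 ≤ L) :
    {v | P.center v ∈ closedBall p L}.ncard ≤ (2 * L + 1) ^ 2 := by
  rw [ncard_eq_toFinset_card _ (P.finite_setOf_center_mem_closedBall p L)]
  exact P.card_le_of_mem_closedBall hL _ fun v hv => by simpa using hv

theorem le_mul_sqrt_ncard_of_ball_subset {p : Plane} {L r : ℝ} (hr : 0 ≤ r) {s : Set V}
    (hs : s.Finite) (hcov : ball p L ⊆ ⋃ v ∈ s, closedBall (P.center v) r) :
    L ≤ r * √s.ncard := by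
  rcases le_or_gt L 0 with hL | hL
  · exact hL.trans (by positivity)
  have harea : L ^ 2 ≤ s.ncard * r ^ 2 := by
    rw [ncard_eq_toFinset_card _ hs, ← finrank_euclideanSpace_fin (𝕜 := ℝ) (n := 2)]
    exact pow_le_card_mul_pow_of_ball_subset hr hL (by simpa using hcov)
  refine le_of_sq_le_sq ?_ (by positivity)
  rwa [mul_pow, Real.sq_sqrt (Nat.cast_nonneg _), mul_comm]

end Distances

section Drawing

/-- The union of the edges at `v`. The degenerate edge from `v` to itself is included, so that the
star of an isolated vertex is its center. -/
def edgeStar (v : V) : Set Plane :=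
  ⋃ w ∈ {w | P.center w ∈ closedBall (P.center v) 1}, segment ℝ (P.center v) (P.center w)

theorem mem_edgeStar {v : V} {p : Plane} : p ∈ P.edgeStar v ↔
    ∃ w, dist (P.center v) (P.center w) ≤ 1 ∧ p ∈ segment ℝ (P.center v) (P.center w) := by
  simp only [edgeStar, mem_closedBall', mem_iUnion, mem_ofPred_eq, exists_prop]

theorem center_mem_edgeStar (v : V) : P.center v ∈ P.edgeStar v :=
  P.mem_edgeStar.2 ⟨v, (dist_self _).trans_le zero_le_one, left_mem_segment ..⟩

theorem drawing_eq_iUnion_edgeStar : P.drawing = ⋃ v, P.edgeStar v := by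
  ext p
  simp only [mem_iUnion, mem_edgeStar]
  constructor
  · rintro (⟨v, rfl⟩ | ⟨v, w, hvw, hp⟩)
    · exact ⟨v, P.mem_edgeStar.1 (P.center_mem_edgeStar v)⟩
    · exact ⟨v, w, le_of_eq hvw, hp⟩
  · rintro ⟨v, w, hvw, hp⟩
    rcases eq_or_ne v w with rfl | hne
    · rw [segment_same] at hp
      exact Or.inl ⟨v, hp.symm⟩
    · exact Or.inr ⟨v, w, hvw.antisymm (P.one_le_dist hne), hp⟩

theorem isClosed_edgeStar (v : V) : IsClosed (P.edgeStar v) := by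
  refine (P.finite_setOf_center_mem_closedBall _ _).isClosed_biUnion fun w _ => ?_
  rw [segment_eq_image_lineMap]
  exact (isCompact_Icc.image (by fun_prop)).isClosed

theorem isPreconnected_edgeStar (v : V) : IsPreconnected (P.edgeStar v) := by
  have hstar : StarConvex ℝ (P.center v) (P.edgeStar v) :=
    starConvex_iUnion₂ fun w _ =>
      (convex_segment _ _).starConvex (left_mem_segment ℝ (P.center v) (P.center w))
  exact (hstar.isPathConnected (P.center_mem_edgeStar v)).isConnected.isPreconnected

theorem locallyFinite_edgeStar : LocallyFinite P.edgeStar := by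
  intro p
  refine ⟨ball p 1, ball_mem_nhds p one_pos,
    (P.finite_setOf_center_mem_closedBall p 2).subset ?_⟩
  rintro v ⟨z, hz, hzp⟩
  obtain ⟨w, hvw, hzw⟩ := P.mem_edgeStar.1 hz
  have hzv : z ∈ closedBall (P.center v) 1 := (convex_closedBall _ _).segment_subset
    (mem_closedBall_self zero_le_one) (mem_closedBall'.2 hvw) hzw
  rw [mem_ofPred_eq, mem_closedBall]
  linarith [dist_triangle_left (P.center v) p z, mem_closedBall.1 hzv, mem_ball.1 hzp]

theorem isClosed_drawing : IsClosed P.drawing :=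
  P.drawing_eq_iUnion_edgeStar ▸ P.locallyFinite_edgeStar.isClosed_iUnion P.isClosed_edgeStar

theorem dense_compl_drawing : Dense P.drawingᶜ := by
  have hcount : Countable V := countable_univ_iff.1 <|
    P.locallyFinite_edgeStar.countable_univ fun v => ⟨_, P.center_mem_edgeStar v⟩
  refine Measure.dense_of_ae (μ := volume) (p := (· ∉ P.drawing)) ?_
  rw [← measure_eq_zero_iff_ae_notMem, drawing_eq_iUnion_edgeStar]
  refine measure_iUnion_null fun v => ?_
  refine (measure_biUnion_null_iff (P.finite_setOf_center_mem_closedBall _ _).countable).2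
    fun w _ => addHaar_segment volume ?_ _ _
  rw [finrank_euclideanSpace_fin]
  exact one_lt_two

theorem isConnected_drawing (hconn : P.graph.Connected) : IsConnected P.drawing := by
  have := hconn.nonempty
  rw [drawing_eq_iUnion_edgeStar]
  refine IsConnected.iUnion_of_reflTransGen
    (fun v => ⟨⟨_, P.center_mem_edgeStar v⟩, P.isPreconnected_edgeStar v⟩) fun v w => ?_
  have hadj (a b : V) (hab : P.graph.Adj a b) : (P.edgeStar a ∩ P.edgeStar b).Nonempty :=
    ⟨P.center b, P.mem_edgeStar.2 ⟨b, le_of_eq hab, right_mem_segment ..⟩, P.center_mem_edgeStar b⟩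
  exact Relation.ReflTransGen.mono hadj _ _
    ((P.graph.reachable_iff_reflTransGen v w).1 (hconn.preconnected v w))

theorem le_two_mul_dist_of_mem_edgeStar {v w : V} (hvw : P.graph.Adj v w) {t : ℝ} (ht : 0 ≤ t)
    {p : Plane} (hp : p ∈ P.edgeStar v) (hpvw : p ∉ segment ℝ (P.center v) (P.center w)) :
    t ≤ 2 * dist p (AffineMap.lineMap (P.center v) (P.center w) t) := by
  obtain ⟨b, hvb, hpb⟩ := P.mem_edgeStar.1 hp
  have hwb : w ≠ b := fun h => hpvw (h ▸ hpb)
  rw [segment_eq_image_lineMap] at hpb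
  obtain ⟨s, hs, rfl⟩ := hpb
  refine le_of_sq_le_sq ?_ (by positivity)
  linarith [sq_le_four_mul_dist_sq_lineMap_lineMap_left hvw hvb (P.one_le_dist hwb) hs.1 ht]

theorem min_le_two_mul_dist_of_mem_drawing {v w : V} (hvw : P.graph.Adj v w) {t : ℝ}
    (ht : t ∈ Icc (0 : ℝ) 1) {p : Plane} (hp : p ∈ P.drawing)
    (hpvw : p ∉ segment ℝ (P.center v) (P.center w)) :
    min t (1 - t) ≤ 2 * dist p (AffineMap.lineMap (P.center v) (P.center w) t) := by
  by_cases hpv : p ∈ P.edgeStar v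
  · exact (min_le_left _ _).trans (P.le_two_mul_dist_of_mem_edgeStar hvw ht.1 hpv hpvw)
  by_cases hpw : p ∈ P.edgeStar w
  · rw [segment_symm] at hpvw
    rw [← AffineMap.lineMap_apply_one_sub]
    exact (min_le_right _ _).trans
      (P.le_two_mul_dist_of_mem_edgeStar hvw.symm (sub_nonneg.2 ht.2) hpw hpvw)
  rw [drawing_eq_iUnion_edgeStar, mem_iUnion] at hp
  obtain ⟨a, hpa⟩ := hp
  obtain ⟨b, hab, hpab⟩ := P.mem_edgeStar.1 hpa
  have hpb : p ∈ P.edgeStar b :=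
    P.mem_edgeStar.2 ⟨a, (dist_comm _ _).trans_le hab, segment_symm ℝ _ (P.center a) ▸ hpab⟩
  have hne {c d : V} (hc : p ∈ P.edgeStar c) (hd : p ∉ P.edgeStar d) :
      1 ≤ dist (P.center c) (P.center d) := P.one_le_dist fun h => hd (h ▸ hc)
  rw [segment_eq_image_lineMap] at hpab
  obtain ⟨s, hs, rfl⟩ := hpab
  have hfar := one_le_two_mul_dist_sq_lineMap_lineMap (le_of_eq hvw) hab (hne hpa hpv)
    (hne hpa hpw) (hne hpb hpv) (hne hpb hpw) hs ht
  have hmin : min t (1 - t) ≤ 1 := (min_le_left _ _).trans ht.2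
  nlinarith [dist_nonneg (x := AffineMap.lineMap (P.center a) (P.center b) s)
    (y := (AffineMap.lineMap (P.center v) (P.center w) t : Plane))]

end Drawing

end PennyConfiguration

namespace PennyConfiguration

variable {V : Type*} (P : PennyConfiguration V)

section Faces

variable {σ : Set Plane}

theorem isOpen_face (hσ : σ ∈ P.faces) : IsOpen σ := by
  obtain ⟨p, -, rfl⟩ := hσ
  exact P.isClosed_drawing.isOpen_compl.connectedComponentIn

theorem isConnected_face (hσ : σ ∈ P.faces) : IsConnected σ := by
  obtain ⟨p, hp, rfl⟩ := hσ
  exact isConnected_connectedComponentIn_iff.2 hp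

theorem face_subset_compl_drawing (hσ : σ ∈ P.faces) : σ ⊆ P.drawingᶜ := by
  obtain ⟨p, -, rfl⟩ := hσ
  exact connectedComponentIn_subset _ _

theorem center_notMem_face (hσ : σ ∈ P.faces) (v : V) : P.center v ∉ σ :=
  fun h => P.face_subset_compl_drawing hσ h (Or.inl ⟨v, rfl⟩)

theorem frontier_face_subset_drawing (hσ : σ ∈ P.faces) : frontier σ ⊆ P.drawing := by
  obtain ⟨p, -, rfl⟩ := hσ
  exact (frontier_connectedComponentIn_subset_compl P.isClosed_drawing.isOpen_compl p).trans_eq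
    (compl_compl _)

theorem isPreconnected_compl_face (hconn : P.graph.Connected) (hσ : σ ∈ P.faces) :
    IsPreconnected σᶜ := by
  obtain ⟨p, -, rfl⟩ := hσ
  exact isPreconnected_compl_connectedComponentIn_compl P.isClosed_drawing
    (P.isConnected_drawing hconn) p

theorem subset_face_of_isPreconnected (hσ : σ ∈ P.faces) {s : Set Plane} (hs : IsPreconnected s)
    (hdrawing : s ⊆ P.drawingᶜ) (hmeet : (s ∩ σ).Nonempty) : s ⊆ σ := by
  obtain ⟨p, -, rfl⟩ := hσ
  obtain ⟨z, hzs, hzσ⟩ := hmeet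
  rw [connectedComponentIn_eq hzσ]
  exact hs.subset_connectedComponentIn hzs hdrawing

theorem face_eq_of_mem {τ : Set Plane} (hσ : σ ∈ P.faces) (hτ : τ ∈ P.faces) {p : Plane}
    (hpσ : p ∈ σ) (hpτ : p ∈ τ) : σ = τ := by
  refine Subset.antisymm ?_ ?_
  · exact P.subset_face_of_isPreconnected hτ (P.isConnected_face hσ).isPreconnected
      (P.face_subset_compl_drawing hσ) ⟨p, hpσ, hpτ⟩
  · exact P.subset_face_of_isPreconnected hσ (P.isConnected_face hτ).isPreconnected
      (P.face_subset_compl_drawing hτ) ⟨p, hpτ, hpσ⟩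

theorem exists_face_of_notMem_drawing {p : Plane} (hp : p ∉ P.drawing) : ∃ σ ∈ P.faces, p ∈ σ :=
  ⟨_, ⟨p, hp, rfl⟩, mem_connectedComponentIn hp⟩

theorem exists_face_inter_nonempty {s : Set Plane} (hs : IsOpen s) (hne : s.Nonempty) :
    ∃ σ ∈ P.faces, (s ∩ σ).Nonempty := by
  obtain ⟨z, hzs, hz⟩ := P.dense_compl_drawing.inter_open_nonempty s hs hne
  obtain ⟨σ, hσ, hzσ⟩ := P.exists_face_of_notMem_drawing hz
  exact ⟨σ, hσ, z, hzs, hzσ⟩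

/-- The vertices at which a face has a corner. -/
def cornerVertices (σ : Set Plane) : Set V := {v | (σ ∩ P.penny v).Nonempty}

theorem encard_cornerVertices_le (σ : Set Plane) :
    (P.cornerVertices σ).encard ≤ P.facialDegree σ := by
  choose! f hf using fun v (hv : v ∈ P.cornerVertices σ) => hv
  refine encard_le_encard_of_injOn (f := fun v => connectedComponentIn (σ ∩ P.penny v) (f v))
    (fun v hv => ⟨v, f v, hf v hv, rfl⟩) fun v _ w hw hvw => ?_
  have hfw : f w ∈ connectedComponentIn (σ ∩ P.penny v) (f v) :=
    hvw.superset (mem_connectedComponentIn (hf w hw))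
  by_contra hne
  exact disjoint_left.1 (P.pairwise_disjoint hne) (connectedComponentIn_subset _ _ hfw).2
    (hf w hw).2

theorem penny_inter_frontier_nonempty (hσ : σ ∈ P.faces) {v : V} (hv : v ∈ P.cornerVertices σ) :
    (P.penny v ∩ frontier σ).Nonempty :=
  inter_frontier_nonempty_of_isPreconnected (convex_ball _ _).isPreconnected
    (inter_comm σ _ ▸ hv) ⟨P.center v, mem_ball_self one_half_pos, P.center_notMem_face hσ v⟩

end Faces

section FaceStars

variable {σ : Set Plane} {v w : V}

/-- The points near which every face has a corner at `v`: the interior of the union of the closures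
of the faces around `v`. -/
def faceStar (v : V) : Set Plane :=
  interior {p | ∀ σ ∈ P.faces, p ∈ σ → v ∈ P.cornerVertices σ}

theorem isOpen_faceStar (v : V) : IsOpen (P.faceStar v) := isOpen_interior

theorem mem_cornerVertices_of_mem_faceStar (hσ : σ ∈ P.faces) {p : Plane} (hpσ : p ∈ σ)
    (hp : p ∈ P.faceStar v) : v ∈ P.cornerVertices σ :=
  interior_subset hp σ hσ hpσ

theorem penny_subset_faceStar (v : V) : P.penny v ⊆ P.faceStar v :=
  interior_maximal (fun p hp _ _ hpσ => ⟨p, hpσ, hp⟩) isOpen_ball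

theorem face_subset_faceStar (hσ : σ ∈ P.faces) (hv : v ∈ P.cornerVertices σ) :
    σ ⊆ P.faceStar v :=
  interior_maximal (fun _ hpσ _ hτ hpτ => P.face_eq_of_mem hσ hτ hpσ hpτ ▸ hv) (P.isOpen_face hσ)

theorem add_smul_sub_notMem_drawing (hvw : P.graph.Adj v w) {m t u : ℝ} (ht : t ∈ Icc m (1 - m))
    (hu : u ∈ Icc m (1 - m)) {z : Plane} (hz : z ∉ P.drawing)
    (hzt : dist z (AffineMap.lineMap (P.center v) (P.center w) t) < m / 2) :
    z + (u - t) • (P.center w - P.center v) ∉ P.drawing := by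
  have hvw_dist : dist (P.center v) (P.center w) = 1 := hvw
  have hm : 0 < m := by linarith [dist_nonneg.trans_lt hzt]
  set d := P.center w - P.center v with hd
  have hshift (a r : ℝ) : (AffineMap.lineMap (P.center v) (P.center w) (a + r) : Plane) =
      AffineMap.lineMap (P.center v) (P.center w) a + r • d := by
    rw [AffineMap.lineMap_apply_module, AffineMap.lineMap_apply_module, hd]
    module
  have hdist : dist (z + (u - t) • d) (AffineMap.lineMap (P.center v) (P.center w) u) =
      dist z (AffineMap.lineMap (P.center v) (P.center w) t) := by
    rw [← add_sub_cancel t u, hshift, add_sub_cancel, dist_add_right]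
  intro hz'
  by_cases hseg : z + (u - t) • d ∈ segment ℝ (P.center v) (P.center w)
  · rw [segment_eq_image_lineMap] at hseg
    obtain ⟨s, -, hs⟩ := hseg
    have hsu : |s - u| < m / 2 := by
      rwa [← hdist, ← hs, dist_lineMap_lineMap, hvw_dist, mul_one, Real.dist_eq] at hzt
    rw [abs_lt] at hsu
    refine hz (Or.inr ⟨v, w, hvw, ?_⟩)
    rw [segment_eq_image_lineMap]
    refine ⟨s + (t - u), ⟨by linarith [ht.1], by linarith [ht.2]⟩, ?_⟩
    rw [hshift, hs, add_assoc, ← add_smul, sub_add_sub_cancel, sub_self, zero_smul, add_zero]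
  · have hmin := P.min_le_two_mul_dist_of_mem_drawing hvw (t := u)
      ⟨by linarith [hu.1], by linarith [hu.2]⟩ hz' hseg
    have hmu : m ≤ min u (1 - u) := le_min hu.1 (by linarith [hu.2])
    linarith

/- From a point close to the edge one can slide towards `v`, parallel to the edge, until the penny
of `v` is reached, without meeting the drawing. -/
theorem openSegment_subset_faceStar (hvw : P.graph.Adj v w) :
    openSegment ℝ (P.center v) (P.center w) ⊆ P.faceStar v := by
  rw [openSegment_eq_image_lineMap]
  rintro _ ⟨t, ⟨ht₀, ht₁⟩, rfl⟩
  obtain ⟨m, hm, hmt⟩ : ∃ m > 0, m ≤ min (min t (1 - t)) (1 / 4) :=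
    ⟨_, lt_min (lt_min ht₀ (sub_pos.2 ht₁)) (by norm_num), le_rfl⟩
  obtain ⟨⟨hmt, hmt'⟩, hm4⟩ : (m ≤ t ∧ m ≤ 1 - t) ∧ m ≤ 1 / 4 := by
    simpa only [le_min_iff] using hmt
  refine mem_interior.2 ⟨ball _ (m / 2), fun z hz σ hσ hzσ => ?_, isOpen_ball,
    mem_ball_self (half_pos hm)⟩
  set d := P.center w - P.center v with hd
  have hslide : (fun u : ℝ => z + (u - t) • d) '' Icc m t ⊆ σ := by
    refine P.subset_face_of_isPreconnected hσ (isPreconnected_Icc.image _ (by fun_prop)) ?_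
      ⟨z, ⟨t, ⟨hmt, le_rfl⟩, by simp⟩, hzσ⟩
    rintro _ ⟨u, hu, rfl⟩
    exact P.add_smul_sub_notMem_drawing hvw ⟨hmt, by linarith⟩ ⟨hu.1, by linarith [hu.2]⟩
      (P.face_subset_compl_drawing hσ hzσ) hz
  refine ⟨z + (m - t) • d, hslide ⟨m, ⟨le_rfl, hmt⟩, rfl⟩, ?_⟩
  have hd_norm : ‖d‖ = 1 := by rw [hd, ← dist_eq_norm, dist_comm]; exact hvw
  have hsplit : z + (m - t) • d - P.center v =
      (z - AffineMap.lineMap (P.center v) (P.center w) t) + m • d := by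
    rw [AffineMap.lineMap_apply_module, hd]
    module
  rw [penny, mem_ball, dist_eq_norm, hsplit]
  rw [mem_ball, dist_eq_norm] at hz
  have hmd : ‖m • d‖ = m := by rw [norm_smul, hd_norm, mul_one, Real.norm_of_nonneg hm.le]
  linarith [norm_add_le (z - AffineMap.lineMap (P.center v) (P.center w) t) (m • d)]

theorem exists_mem_faceStar_of_mem_drawing {q : Plane} (hq : q ∈ P.drawing) :
    ∃ v, q ∈ P.faceStar v ∧ dist q (P.center v) ≤ 1 / 2 := by
  have hcenter (v : V) : P.center v ∈ P.faceStar v ∧ dist (P.center v) (P.center v) ≤ 1 / 2 :=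
    ⟨P.penny_subset_faceStar v (mem_ball_self one_half_pos), by rw [dist_self]; positivity⟩
  rcases hq with ⟨v, rfl⟩ | ⟨v, w, hvw, hq⟩
  · exact ⟨v, hcenter v⟩
  have hvw_dist : dist (P.center v) (P.center w) = 1 := hvw
  have hsum := dist_add_dist_of_mem_segment hq
  rw [← insert_endpoints_openSegment] at hq
  rcases hq with rfl | rfl | hq
  · exact ⟨v, hcenter v⟩
  · exact ⟨w, hcenter w⟩
  rcases le_total (dist q (P.center v)) (1 / 2) with h | h
  · exact ⟨v, P.openSegment_subset_faceStar hvw hq, h⟩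
  · refine ⟨w, P.openSegment_subset_faceStar hvw.symm (openSegment_symm ℝ (P.center v) _ ▸ hq), ?_⟩
    rw [dist_comm] at h
    linarith

theorem exists_cornerVertex_of_mem_frontier (hσ : σ ∈ P.faces) {q : Plane} (hq : q ∈ frontier σ) :
    ∃ v ∈ P.cornerVertices σ, dist q (P.center v) ≤ 1 / 2 := by
  obtain ⟨v, hqv, hv⟩ :=
    P.exists_mem_faceStar_of_mem_drawing (P.frontier_face_subset_drawing hσ hq)
  obtain ⟨z, hzv, hzσ⟩ :=
    mem_closure_iff.1 (frontier_subset_closure hq) _ (P.isOpen_faceStar v) hqv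
  exact ⟨v, P.mem_cornerVertices_of_mem_faceStar hσ hzσ hzv, hv⟩

theorem cornerVertices_nonempty [Nonempty V] (hσ : σ ∈ P.faces) :
    (P.cornerVertices σ).Nonempty := by
  obtain ⟨v⟩ := ‹Nonempty V›
  obtain ⟨q, hq⟩ : (frontier σ).Nonempty := nonempty_frontier_iff.2
    ⟨(P.isConnected_face hσ).nonempty, fun h => P.center_notMem_face hσ v (h ▸ mem_univ _)⟩
  obtain ⟨u, hu, -⟩ := P.exists_cornerVertex_of_mem_frontier hσ hq
  exact ⟨u, hu⟩

theorem exists_mem_faceStar [Nonempty V] (p : Plane) : ∃ v, p ∈ P.faceStar v := by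
  by_cases hp : p ∈ P.drawing
  · obtain ⟨v, hv, -⟩ := P.exists_mem_faceStar_of_mem_drawing hp
    exact ⟨v, hv⟩
  · obtain ⟨σ, hσ, hpσ⟩ := P.exists_face_of_notMem_drawing hp
    obtain ⟨v, hv⟩ := P.cornerVertices_nonempty hσ
    exact ⟨v, P.face_subset_faceStar hσ hv hpσ⟩

end FaceStars

end PennyConfiguration

namespace PennyConfiguration

variable {V : Type*} (P : PennyConfiguration V)

section Volumes

theorem combBall_subset_closedBall (hconn : P.graph.Connected) (x : V) (R : ℝ) :
    P.graph.combBall x R ⊆ {v | P.center v ∈ closedBall (P.center x) R} :=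
  fun v hv => (P.dist_center_le_graph_dist hconn v x).trans hv

theorem finite_combBall (hconn : P.graph.Connected) (x : V) (R : ℝ) :
    (P.graph.combBall x R).Finite :=
  (P.finite_setOf_center_mem_closedBall _ R).subset (P.combBall_subset_closedBall hconn x R)

theorem vol_le (hconn : P.graph.Connected) (x : V) {R : ℝ} (hR : 0 ≤ R) :
    P.graph.vol x R ≤ 4 * (R + 1) ^ 2 := by
  have hncard : P.graph.vol x R ≤ {v | P.center v ∈ closedBall (P.center x) R}.ncard :=
    Nat.cast_le.2 <| ncard_le_ncard (P.combBall_subset_closedBall hconn x R)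
      (P.finite_setOf_center_mem_closedBall _ R)
  nlinarith [P.ncard_setOf_center_mem_closedBall_le (P.center x) hR]

theorem one_le_vol (hconn : P.graph.Connected) (x : V) {R : ℝ} (hR : 0 ≤ R) :
    1 ≤ P.graph.vol x R := by
  have hx : x ∈ P.graph.combBall x R := by
    rwa [SimpleGraph.combBall, mem_ofPred_eq, SimpleGraph.dist_self, Nat.cast_zero]
  exact Nat.one_le_cast.2 ((ncard_pos (P.finite_combBall hconn x R)).2 ⟨x, hx⟩)

end Volumes

section Distortion

variable {σ : Set Plane} {D : ℕ}

theorem graph_dist_le_of_mem_cornerVertices (hconn : P.graph.Connected) (hσ : σ ∈ P.faces)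
    (hdeg : P.facialDegree σ ≤ D) {v w : V} (hv : v ∈ P.cornerVertices σ)
    (hw : w ∈ P.cornerVertices σ) : P.graph.dist v w ≤ D := by
  obtain ⟨hfin, hcard⟩ := encard_le_coe_iff_finite_ncard_le.1
    ((P.encard_cornerVertices_le σ).trans hdeg)
  have := hfin.to_subtype
  let c (i : P.cornerVertices σ) : Plane := P.center i
  obtain ⟨ε, hε, hgap⟩ := exists_pos_forall_lt_add_imp_le
    (fun ij : P.cornerVertices σ × P.cornerVertices σ => dist (c ij.1) (c ij.2)) 1
  have hcov : thickening (ε / 2) (frontier σ) ⊆ ⋃ i, ball (c i) (1 / 2 + ε / 2) := by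
    intro p hp
    obtain ⟨q, hq, hpq⟩ := mem_thickening_iff.1 hp
    obtain ⟨u, hu, hqu⟩ := P.exists_cornerVertex_of_mem_frontier hσ hq
    exact mem_iUnion.2 ⟨⟨u, hu⟩, (dist_triangle p q _).trans_lt (by linarith)⟩
  have hmeet (i : P.cornerVertices σ) :
      (thickening (ε / 2) (frontier σ) ∩ ball (c i) (1 / 2 + ε / 2)).Nonempty := by
    obtain ⟨z, hzi, hz⟩ := P.penny_inter_frontier_nonempty hσ i.2
    exact ⟨z, self_subset_thickening (half_pos hε) _ hz, ball_subset_ball (by linarith) hzi⟩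
  have hstep (i j : P.cornerVertices σ)
      (hij : (ball (c i) (1 / 2 + ε / 2) ∩ ball (c j) (1 / 2 + ε / 2)).Nonempty) :
      P.graph.dist i j ≤ 1 := by
    obtain ⟨z, hzi, hzj⟩ := hij
    exact P.graph_dist_le_one (hgap (i, j) ((dist_triangle_left _ _ z).trans_lt
      (by linarith [mem_ball.1 hzi, mem_ball.1 hzj])))
  have hdist := dist_map_le_mul_card_of_cover
    (isPreconnected_thickening_frontier (P.isConnected_face hσ).isPreconnected
      (P.isPreconnected_compl_face hconn hσ) (half_pos hε))
    (fun _ => isOpen_ball) hcov hmeet hconn hstep ⟨v, hv⟩ ⟨w, hw⟩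
  rw [one_mul, Nat.card_coe_set_eq] at hdist
  exact hdist.trans hcard

theorem face_subset_closedBall [Infinite V] (hconn : P.graph.Connected) (hσ : σ ∈ P.faces)
    (hdeg : P.facialDegree σ ≤ D) {v : V} (hv : v ∈ P.cornerVertices σ) :
    σ ⊆ closedBall (P.center v) (D + 1 / 2) := by
  intro p hp
  by_contra hpB
  have hfrontier : frontier σ ⊆ closedBall (P.center v) (D + 1 / 2) := by
    intro q hq
    obtain ⟨u, hu, hqu⟩ := P.exists_cornerVertex_of_mem_frontier hσ hq
    have huv := P.dist_center_le_graph_dist hconn u v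
    have huv' : (P.graph.dist u v : ℝ) ≤ D :=
      mod_cast P.graph_dist_le_of_mem_cornerVertices hconn hσ hdeg hu hv
    exact (dist_triangle q (P.center u) _).trans (by linarith)
  have hrank : 1 < Module.rank ℝ Plane := by
    rw [← Module.finrank_eq_rank, finrank_euclideanSpace_fin]
    exact_mod_cast one_lt_two
  have hcompl : (closedBall (P.center v) (D + 1 / 2))ᶜ ⊆ σ := by
    intro q hqB
    by_contra hq
    obtain ⟨z, hzB, hz⟩ := inter_frontier_nonempty_of_isPreconnected
      (isPreconnected_compl_closedBall hrank _ (by positivity)) ⟨p, hpB, hp⟩ ⟨q, hqB, hq⟩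
    exact hzB (hfrontier hz)
  have hcenters : univ ⊆ {u | P.center u ∈ closedBall (P.center v) (D + 1 / 2)} :=
    fun u _ => by_contra fun hu => P.center_notMem_face hσ u (hcompl hu)
  exact infinite_univ ((P.finite_setOf_center_mem_closedBall _ _).subset hcenters)

variable (hconn : P.graph.Connected) (hD : ∀ σ ∈ P.faces, P.facialDegree σ ≤ D)
include hconn hD

theorem graph_dist_le_of_faceStar_inter_nonempty {v w : V}
    (h : (P.faceStar v ∩ P.faceStar w).Nonempty) : P.graph.dist v w ≤ D := by
  obtain ⟨σ, hσ, z, ⟨hzv, hzw⟩, hzσ⟩ :=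
    P.exists_face_inter_nonempty ((P.isOpen_faceStar v).inter (P.isOpen_faceStar w)) h
  exact P.graph_dist_le_of_mem_cornerVertices hconn hσ (hD σ hσ)
    (P.mem_cornerVertices_of_mem_faceStar hσ hzσ hzv)
    (P.mem_cornerVertices_of_mem_faceStar hσ hzσ hzw)

variable [Infinite V]

theorem faceStar_subset_closedBall (v : V) :
    P.faceStar v ⊆ closedBall (P.center v) (D + 1 / 2) := by
  intro p hp
  by_contra hpB
  obtain ⟨σ, hσ, z, ⟨hzv, hzB⟩, hzσ⟩ := P.exists_face_inter_nonempty
    ((P.isOpen_faceStar v).inter isClosed_closedBall.isOpen_compl) ⟨p, hp, hpB⟩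
  exact hzB (P.face_subset_closedBall hconn hσ (hD σ hσ)
    (P.mem_cornerVertices_of_mem_faceStar hσ hzσ hzv) hzσ)

theorem graph_dist_le_of_dist_le_one {p q : Plane} {v w : V} (hp : p ∈ P.faceStar v)
    (hq : q ∈ P.faceStar w) (hpq : dist p q ≤ 1) :
    P.graph.dist v w ≤ D * (2 * D + 4) ^ 2 := by
  let N : Set V := {u | (segment ℝ p q ∩ P.faceStar u).Nonempty}
  have hN : N ⊆ {u | P.center u ∈ closedBall p (D + 3 / 2)} := by
    rintro u ⟨z, hz, hzu⟩
    have hzu' := mem_closedBall'.1 (P.faceStar_subset_closedBall hconn hD u hzu)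
    have hzp : dist z p ≤ 1 := by
      linarith [dist_add_dist_of_mem_segment hz, dist_nonneg (x := z) (y := q), dist_comm z p]
    exact (dist_triangle _ z p).trans (by linarith)
  have hfin := P.finite_setOf_center_mem_closedBall p (D + 3 / 2)
  have hcard : N.ncard ≤ (2 * D + 4) ^ 2 := by
    refine (ncard_le_ncard hN hfin).trans ?_
    have hle := P.ncard_setOf_center_mem_closedBall_le p (L := D + 3 / 2) (by positivity)
    rw [show 2 * ((D : ℝ) + 3 / 2) + 1 = 2 * D + 4 by ring] at hle
    exact_mod_cast hle
  have := (hfin.subset hN).to_subtype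
  have hcov : segment ℝ p q ⊆ ⋃ u : N, P.faceStar u := fun z hz => by
    obtain ⟨u, hu⟩ := P.exists_mem_faceStar z
    exact mem_iUnion.2 ⟨⟨u, z, hz, hu⟩, hu⟩
  calc P.graph.dist v w ≤ D * Nat.card N :=
        dist_map_le_mul_card_of_cover (convex_segment p q).isPreconnected
          (fun u : N => P.isOpen_faceStar u) hcov (fun u => u.2) hconn
          (fun _ _ => P.graph_dist_le_of_faceStar_inter_nonempty hconn hD)
          ⟨v, p, left_mem_segment .., hp⟩ ⟨w, q, right_mem_segment .., hq⟩
    _ ≤ D * (2 * D + 4) ^ 2 := Nat.mul_le_mul_left D (Nat.card_coe_set_eq N ▸ hcard)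

/-- A positive bound for the graph distance of two vertices whose face stars contain points at
Euclidean distance at most one, if all facial degrees are at most `D`. -/
def distortionConst (D : ℕ) : ℕ := D * (2 * D + 4) ^ 2 + 1

theorem ball_subset_iUnion_closedBall (x : V) (L : ℝ) :
    ball (P.center x) L ⊆ ⋃ v ∈ P.graph.combBall x (distortionConst D * (L + 1)),
      closedBall (P.center v) (D + 1 / 2) := by
  intro p hp
  obtain ⟨v, hv⟩ := P.exists_mem_faceStar p
  have hx : P.center x ∈ P.faceStar x := P.penny_subset_faceStar x (mem_ball_self one_half_pos)
  have hdist : P.graph.dist v x ≤ (⌊dist p (P.center x)⌋₊ + 1) * distortionConst D :=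
    dist_le_mul_of_unit_scale hconn P.exists_mem_faceStar
      (fun hp hq hpq => (P.graph_dist_le_of_dist_le_one hconn hD hp hq hpq).trans (Nat.le_succ _))
      _ hv hx (Nat.lt_floor_add_one _).le
  refine mem_biUnion ?_ (P.faceStar_subset_closedBall hconn hD v hv)
  have hfloor : (⌊dist p (P.center x)⌋₊ : ℝ) ≤ L :=
    (Nat.floor_le dist_nonneg).trans (mem_ball.1 hp).le
  calc (P.graph.dist v x : ℝ) ≤ (⌊dist p (P.center x)⌋₊ + 1) * distortionConst D := mod_cast hdist
    _ ≤ distortionConst D * (L + 1) := by rw [mul_comm]; gcongr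

theorem sq_le_mul_vol (x : V) {R : ℝ} (hR : 0 ≤ R) :
    (R + 1) ^ 2 ≤ (distortionConst D * (D + 3)) ^ 2 * P.graph.vol x R := by
  have hK : (1 : ℝ) ≤ distortionConst D := mod_cast Nat.le_add_left 1 _
  have hradius : (distortionConst D : ℝ) * (R / distortionConst D - 1 + 1) = R := by
    rw [sub_add_cancel, mul_div_cancel₀ R (by positivity)]
  have hcov := P.ball_subset_iUnion_closedBall hconn hD x (R / distortionConst D - 1)
  rw [hradius] at hcov
  have hL : R / distortionConst D - 1 ≤ (D + 1 / 2) * √(P.graph.vol x R) :=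
    P.le_mul_sqrt_ncard_of_ball_subset (by positivity) (P.finite_combBall hconn x R) hcov
  have hvol : 1 ≤ √(P.graph.vol x R) := Real.one_le_sqrt.2 (P.one_le_vol hconn x hR)
  have hsqrt : R + 1 ≤ distortionConst D * (D + 3) * √(P.graph.vol x R) := calc
    R + 1 ≤ distortionConst D * (R / distortionConst D - 1 + 1) + distortionConst D := by
        rw [hradius]; linarith
    _ ≤ distortionConst D * ((D + 1 / 2) * √(P.graph.vol x R) + 1 + 1) := by
        rw [← mul_add_one]; gcongr
    _ ≤ distortionConst D * (D + 3) * √(P.graph.vol x R) := by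
        rw [mul_assoc]; gcongr; linarith
  calc (R + 1) ^ 2 ≤ (distortionConst D * (D + 3) * √(P.graph.vol x R)) ^ 2 := by gcongr
    _ = (distortionConst D * (D + 3)) ^ 2 * P.graph.vol x R := by
        rw [mul_pow, Real.sq_sqrt (zero_le_one.trans (P.one_le_vol hconn x hR))]

end Distortion

end PennyConfiguration

theorem theorem3p5 (D : ℕ) :
    ∃ C₁ C₂ C₃ C₄ : ℝ, 0 < C₁ ∧ 0 < C₂ ∧ 0 < C₃ ∧ 0 < C₄ ∧
      ∀ (V : Type*) [Infinite V] (P : PennyConfiguration V),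
        P.graph.Connected →
        (∀ σ ∈ P.faces, P.facialDegree σ ≤ (D : ℕ∞)) →
          P.graph.VolumeDoubling C₁ ∧
          P.graph.WeakRelativeVolumeComparison C₂ 2 ∧
          ∀ (x : V) (R : ℝ), 1 ≤ R →
            (P.graph.combBall x R).Finite ∧
            C₃ * R ^ 2 ≤ P.graph.vol x R ∧ P.graph.vol x R ≤ C₄ * R ^ 2 := by
  obtain ⟨A, hA, hA_eq⟩ : ∃ A : ℝ, 0 < A ∧
      A = (PennyConfiguration.distortionConst D * (D + 3)) ^ 2 :=
    ⟨_, by unfold PennyConfiguration.distortionConst; positivity, rfl⟩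
  refine ⟨A * 4 * 2 ^ (2 : ℝ), A * 4, A⁻¹, 16, by positivity, by positivity, by positivity,
    by norm_num, fun V _ P hconn hD => ?_⟩
  have hlower (x : V) (R : ℝ) (hR : 0 ≤ R) : (R + 1) ^ 2 ≤ A * P.graph.vol x R :=
    hA_eq ▸ P.sq_le_mul_vol hconn hD x hR
  have hcomparison : P.graph.WeakRelativeVolumeComparison (A * 4) 2 :=
    weakRelativeVolumeComparison_of_vol_bounds hA.le zero_le_four zero_le_two
      (by simpa only [Real.rpow_two] using hlower)
      (by simpa only [Real.rpow_two] using fun x R hR => P.vol_le hconn x hR)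
  refine ⟨volumeDoubling_of_weakRelativeVolumeComparison
    (fun x R hR => zero_lt_one.trans_le (P.one_le_vol hconn x hR.le)) hcomparison, hcomparison,
    fun x R hR => ⟨P.finite_combBall hconn x R, ?_, ?_⟩⟩
  · rw [inv_mul_le_iff₀ hA]
    nlinarith [hlower x R (by linarith)]
  · nlinarith [P.vol_le hconn x (R := R) (by linarith)]
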